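/- Let $\mathfrak A$ be a (not necessarily unital) $C^*$-algebra and let $H$, $K$ be Hilbert $\mathfrak A$-modules. Let $T\in\mathcal L(H,K)$ be an adjointable operator, that is, a map $T:H\to K$ for which there is a map $T^*:K\to H$ with $\langle Tx,y\rangle=\langle x,T^*y\rangle$ for all $x\in H$, $y\in K$. Write $|T|=(T^*T)^{1/2}$ and $|T^*|=(TT^*)^{1/2}$; the square roots and the powers below are taken by continuous functional calculus in the $C^*$-algebras $\mathcal L(H)$ and $\mathcal L(K)$ of adjointable operators on $H$ and on $K$, and the $0$-th power is the identity. Then, for every real $\alpha\in[0,2]$ and all $x\in H$, $y\in K$, $$\|\langle Tx,y\rangle\|^2\le\big\|\langle|T|^\alpha x,x\rangle\big\|\cdot\big\|\langle|T^*|^{2-\alpha}y,y\rangle\big\|.$$ -/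

import Mathlib

/-- Adjointable operators between two (Hilbert) C⋆-modules `H`, `K` over `A`: maps `T : H → K`
for which there is a map `T* : K → H` with `⟨T x, y⟩ = ⟨x, T* y⟩`. The adjoint is stored as
data; it is determined by `T` (see `AdjointableMap.ext`). Linearity and boundedness are not
assumed: they are automatic (see `AdjointableMap.toCLM`). -/
structure AdjointableMap (A H K : Type*) [Inner A H] [Inner A K] where
  /-- The underlying map. -/
  toFun : H → K
  /-- The underlying map of the adjoint. -/
  adjFun : K → H
  inner_adj : ∀ x y, inner A (toFun x) y = inner A x (adjFun y)

namespace AdjointableMap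

instance {A H K : Type*} [Inner A H] [Inner A K] :
    CoeFun (AdjointableMap A H K) (fun _ => H → K) := ⟨toFun⟩

section General

variable {A H K : Type*} [NonUnitalCStarAlgebra A] [PartialOrder A]
  [NormedAddCommGroup H] [NormedSpace ℂ H] [SMul A H] [CStarModule A H]
  [NormedAddCommGroup K] [NormedSpace ℂ K] [SMul A K] [CStarModule A K]

theorem eq_of_inner_left {x y : H} (h : ∀ z, inner A x z = inner A y z) : x = y := by
  rw [← sub_eq_zero, ← CStarModule.inner_self (A := A), CStarModule.inner_sub_left, h, sub_self]

theorem eq_of_inner_right {x y : H} (h : ∀ z, inner A z x = inner A z y) : x = y := by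
  rw [← sub_eq_zero, ← CStarModule.inner_self (A := A), CStarModule.inner_sub_right, h, sub_self]

@[ext]
theorem ext {S T : AdjointableMap A H K} (h : ∀ x, S x = T x) : S = T := by
  obtain ⟨s, s', hs⟩ := S
  obtain ⟨t, t', ht⟩ := T
  obtain rfl : s = t := funext h
  obtain rfl : s' = t' := funext fun y =>
    eq_of_inner_right (A := A) fun z => by rw [← hs, ← ht]
  rfl

/-- The adjoint `T*`. -/
def adjoint (T : AdjointableMap A H K) : AdjointableMap A K H where
  toFun := T.adjFun
  adjFun := T.toFun
  inner_adj x y := by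
    rw [← CStarModule.star_inner, ← T.inner_adj, CStarModule.star_inner]

/-- Composition of adjointable operators. -/
def comp {L : Type*} [NormedAddCommGroup L] [NormedSpace ℂ L] [SMul A L] [CStarModule A L]
    (S : AdjointableMap A K L) (T : AdjointableMap A H K) : AdjointableMap A H L where
  toFun x := S (T x)
  adjFun z := T.adjFun (S.adjFun z)
  inner_adj x z := by rw [S.inner_adj, T.inner_adj]

/-- An adjointable operator is linear. -/
def toLinear (T : AdjointableMap A H K) : H →ₗ[ℂ] K where
  toFun := T
  map_add' x y := eq_of_inner_left (A := A) fun z => by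
    simp only [T.inner_adj, CStarModule.inner_add_left]
  map_smul' c x := eq_of_inner_left (A := A) fun z => by
    simp only [T.inner_adj, CStarModule.inner_smul_left_complex, RingHom.id_apply]

/-- An adjointable operator between Hilbert C⋆-modules is bounded. -/
def toCLM [StarOrderedRing A] [CompleteSpace H] [CompleteSpace K]
    (T : AdjointableMap A H K) : H →L[ℂ] K where
  toLinearMap := T.toLinear
  cont := by
    refine LinearMap.continuous_of_seq_closed_graph _ fun u x y hu hT => ?_
    refine eq_of_inner_left (A := A) fun z => ?_
    have h1 : Filter.Tendsto (fun n => inner A (T.toLinear (u n)) z) Filter.atTop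
        (nhds (inner A y z)) :=
      ((CStarModule.continuous_inner (A := A) (E := K)).tendsto (y, z)).comp
        (hT.prodMk_nhds tendsto_const_nhds)
    have h2 : Filter.Tendsto (fun n => inner A (u n) (T.adjFun z)) Filter.atTop
        (nhds (inner A x (T.adjFun z))) :=
      ((CStarModule.continuous_inner (A := A) (E := H)).tendsto (x, T.adjFun z)).comp
        (hu.prodMk_nhds tendsto_const_nhds)
    have h3 : (fun n => inner A (T.toLinear (u n)) z) = fun n => inner A (u n) (T.adjFun z) :=
      funext fun n => T.inner_adj _ _
    rw [h3] at h1
    exact (tendsto_nhds_unique h1 h2).trans (T.inner_adj x z).symm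

end General

/-! ### The C⋆-algebra of adjointable operators on a Hilbert C⋆-module -/

section Algebra

variable {A H : Type*} [NonUnitalCStarAlgebra A] [PartialOrder A]
  [NormedAddCommGroup H] [NormedSpace ℂ H] [SMul A H] [CStarModule A H]

instance : Zero (AdjointableMap A H H) := ⟨⟨fun _ => 0, fun _ => 0, by simp⟩⟩

instance : One (AdjointableMap A H H) := ⟨⟨fun x => x, fun x => x, fun _ _ => rfl⟩⟩

instance : Add (AdjointableMap A H H) :=
  ⟨fun S T => ⟨fun x => S x + T x, fun x => S.adjFun x + T.adjFun x, fun x y => by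
    simp [S.inner_adj, T.inner_adj]⟩⟩

instance : Neg (AdjointableMap A H H) :=
  ⟨fun S => ⟨fun x => -S x, fun x => -S.adjFun x, fun x y => by simp [S.inner_adj]⟩⟩

instance : Sub (AdjointableMap A H H) :=
  ⟨fun S T => ⟨fun x => S x - T x, fun x => S.adjFun x - T.adjFun x, fun x y => by
    simp [S.inner_adj, T.inner_adj]⟩⟩

instance : Mul (AdjointableMap A H H) := ⟨fun S T => S.comp T⟩

instance : SMul ℂ (AdjointableMap A H H) :=
  ⟨fun c S => ⟨fun x => c • S x, fun x => star c • S.adjFun x, fun x y => by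
    simp [S.inner_adj]⟩⟩

instance : Star (AdjointableMap A H H) := ⟨adjoint⟩

instance : Ring (AdjointableMap A H H) where
  add_assoc R S T := ext fun x => add_assoc (R x) (S x) (T x)
  zero_add S := ext fun x => zero_add (S x)
  add_zero S := ext fun x => add_zero (S x)
  add_comm S T := ext fun x => add_comm (S x) (T x)
  neg_add_cancel S := ext fun x => neg_add_cancel (S x)
  sub_eq_add_neg S T := ext fun x => sub_eq_add_neg (S x) (T x)
  nsmul := nsmulRec
  zsmul := zsmulRec
  mul_assoc _ _ _ := rfl
  one_mul _ := rfl
  mul_one _ := rfl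
  zero_mul _ := ext fun _ => rfl
  mul_zero S := ext fun _ => S.toLinear.map_zero
  left_distrib R S T := ext fun x => R.toLinear.map_add (S x) (T x)
  right_distrib _ _ _ := ext fun _ => rfl

instance : StarRing (AdjointableMap A H H) where
  star_involutive _ := rfl
  star_mul _ _ := rfl
  star_add _ _ := rfl

theorem one_apply (x : H) : (1 : AdjointableMap A H H) x = x := rfl

theorem add_apply (S T : AdjointableMap A H H) (x : H) : (S + T) x = S x + T x := rfl

theorem sub_apply (S T : AdjointableMap A H H) (x : H) : (S - T) x = S x - T x := rfl

theorem mul_apply (S T : AdjointableMap A H H) (x : H) : (S * T) x = S (T x) := rfl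

theorem smul_apply (c : ℂ) (T : AdjointableMap A H H) (x : H) : (c • T) x = c • T x := rfl

theorem inner_star_right (T : AdjointableMap A H H) (x y : H) :
    inner A x (star T y) = inner A (T x) y := (T.inner_adj x y).symm

theorem inner_star_left (T : AdjointableMap A H H) (x y : H) :
    inner A (star T x) y = inner A x (T y) := (star T).inner_adj x y

instance : Algebra ℂ (AdjointableMap A H H) :=
  letI : Module ℂ (AdjointableMap A H H) :=
    { one_smul := fun S => ext fun x => one_smul ℂ (S x)
      mul_smul := fun c d S => ext fun x => mul_smul c d (S x)
      smul_zero := fun c => ext fun _ => smul_zero c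
      smul_add := fun c S T => ext fun x => smul_add c (S x) (T x)
      add_smul := fun c d S => ext fun x => add_smul c d (S x)
      zero_smul := fun S => ext fun x => zero_smul ℂ (S x) }
  Algebra.ofModule (fun _ _ _ => ext fun _ => rfl) (fun c S T => ext fun x => S.toLinear.map_smul c (T x))

theorem eq_zero_of_inner {T : AdjointableMap A H H} (h : ∀ x, inner A (T x) x = 0) : T = 0 := by
  refine ext fun x => eq_of_inner_left (A := A) fun y => ?_
  have hadd : T (x + y) = T x + T y := T.toLinear.map_add x y
  have hadd' : T (x + Complex.I • y) = T x + Complex.I • T y := by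
    have := T.toLinear.map_add x (Complex.I • y)
    rw [T.toLinear.map_smul] at this
    exact this
  have h1 := h (x + y)
  have h2 := h (x + Complex.I • y)
  have h3 : T (Complex.I • y) = Complex.I • T y := T.toLinear.map_smul _ y
  have hy : inner A (T y) (Complex.I • y) = 0 := by
    rw [CStarModule.inner_smul_right_complex, h, smul_zero]
  simp only [hadd, hadd', CStarModule.inner_add_left, CStarModule.inner_add_right, h, zero_add,
    add_zero, CStarModule.inner_smul_left_complex, CStarModule.inner_smul_right_complex] at h1 h2
  have h4 : inner A (T x) y - inner A (T y) x = 0 := by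
    have h5 := congrArg (fun a => (-Complex.I) • a) h2
    simp only [smul_add, smul_smul, smul_zero] at h5
    simpa [sub_eq_add_neg, add_comm] using h5
  have h6 : (2 : ℂ) • inner A (T x) y = 0 := by
    rw [two_smul]
    calc _ = (inner A (T y) x + inner A (T x) y) + (inner A (T x) y - inner A (T y) x) := by abel
      _ = 0 := by rw [h1, h4, add_zero]
  have h7 : inner A (T x) y = 0 := (smul_eq_zero.mp h6).resolve_left two_ne_zero
  rw [h7]
  exact CStarModule.inner_zero_left.symm

variable [StarOrderedRing A]

/-- The order on operators: `S ≤ T` iff `⟨(T - S) x, x⟩ ≥ 0` for all `x`. In particular `T` is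
positive iff `⟨T x, x⟩ ≥ 0` for all `x`. -/
instance : PartialOrder (AdjointableMap A H H) where
  le S T := ∀ x, 0 ≤ inner A ((T - S) x) x
  le_refl S x := by
    rw [sub_self]
    exact CStarModule.inner_zero_left.ge
  le_trans R S T h1 h2 x := by
    have := add_nonneg (h1 x) (h2 x)
    rw [← CStarModule.inner_add_left, ← add_apply, add_comm, sub_add_sub_cancel] at this
    exact this
  le_antisymm S T h1 h2 := by
    refine (sub_eq_zero.mp (eq_zero_of_inner fun x => le_antisymm ?_ (h1 x))).symm
    have := h2 x
    rw [← neg_sub T S] at this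
    have h3 : inner A ((-(T - S)) x) x = -inner A ((T - S) x) x :=
      CStarModule.inner_neg_left
    rw [h3] at this
    exact neg_nonneg.mp this

theorem nonneg_def {T : AdjointableMap A H H} : 0 ≤ T ↔ ∀ x, 0 ≤ inner A (T x) x := by
  change (∀ x, 0 ≤ inner A ((T - 0) x) x) ↔ _
  rw [sub_zero]

theorem isSelfAdjoint_of_nonneg {T : AdjointableMap A H H} (h : 0 ≤ T) : IsSelfAdjoint T := by
  refine sub_eq_zero.mp (eq_zero_of_inner fun x => ?_)
  rw [sub_apply, CStarModule.inner_sub_left, inner_star_left, ← CStarModule.star_inner,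
    (IsSelfAdjoint.of_nonneg (nonneg_def.mp h x)).star_eq, sub_self]

variable [CompleteSpace H]

/-- The inclusion of adjointable operators into bounded operators. -/
def toCLMHom : AdjointableMap A H H →+* (H →L[ℂ] H) where
  toFun := toCLM
  map_one' := rfl
  map_mul' _ _ := rfl
  map_zero' := rfl
  map_add' _ _ := rfl

theorem toCLMHom_injective : Function.Injective (toCLMHom (A := A) (H := H)) :=
  fun _ _ h => ext fun x => congrArg (fun f : H →L[ℂ] H => f x) h

/-- The operator norm. -/
noncomputable instance : NormedRing (AdjointableMap A H H) :=
  NormedRing.induced _ _ toCLMHom toCLMHom_injective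

theorem norm_def (T : AdjointableMap A H H) : ‖T‖ = ‖T.toCLM‖ := rfl

theorem norm_apply_le (T : AdjointableMap A H H) (x : H) : ‖T x‖ ≤ ‖T‖ * ‖x‖ :=
  T.toCLM.le_opNorm x

noncomputable instance : NormedAlgebra ℂ (AdjointableMap A H H) where
  norm_smul_le c T := norm_smul_le c T.toCLM

instance : StarModule ℂ (AdjointableMap A H H) where
  star_smul _ _ := ext fun _ => rfl

instance : CStarRing (AdjointableMap A H H) where
  norm_mul_self_le T := by
    have key : ‖T‖ ≤ √‖star T * T‖ := by
      refine T.toCLM.opNorm_le_bound (Real.sqrt_nonneg _) fun x => ?_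
      refine le_of_sq_le_sq ?_ (by positivity)
      rw [mul_pow, Real.sq_sqrt (norm_nonneg _)]
      calc ‖T x‖ ^ 2 = ‖inner A ((star T * T) x) x‖ := by
            rw [CStarModule.norm_sq_eq A, mul_apply, inner_star_left]
        _ ≤ ‖(star T * T) x‖ * ‖x‖ := CStarModule.norm_inner_le H
        _ ≤ ‖star T * T‖ * ‖x‖ * ‖x‖ := by gcongr; exact norm_apply_le _ _
        _ = ‖star T * T‖ * ‖x‖ ^ 2 := by ring
    calc ‖T‖ * ‖T‖ ≤ √‖star T * T‖ * √‖star T * T‖ := by gcongr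
      _ = ‖star T * T‖ := Real.mul_self_sqrt (norm_nonneg _)

instance : CompleteSpace (AdjointableMap A H H) := by
  refine Metric.complete_of_cauchySeq_tendsto fun u hu => ?_
  have hiso : Isometry (toCLM (A := A) (H := H) (K := H)) := Isometry.of_dist_eq fun _ _ => rfl
  have hstar : Isometry (star : AdjointableMap A H H → AdjointableMap A H H) := star_isometry
  obtain ⟨T, hT⟩ := cauchySeq_tendsto_of_complete (hiso.uniformContinuous.comp_cauchySeq hu)
  obtain ⟨S, hS⟩ := cauchySeq_tendsto_of_complete
    ((hiso.comp hstar).uniformContinuous.comp_cauchySeq hu)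
  have hTx (x : H) : Filter.Tendsto (fun n => u n x) Filter.atTop (nhds (T x)) :=
    ((ContinuousLinearMap.apply ℂ H x).continuous.tendsto T).comp hT
  have hSx (x : H) : Filter.Tendsto (fun n => star (u n) x) Filter.atTop (nhds (S x)) :=
    ((ContinuousLinearMap.apply ℂ H x).continuous.tendsto S).comp hS
  refine ⟨⟨T, S, fun x y => ?_⟩, ?_⟩
  · have h1 := ((CStarModule.continuous_inner (A := A) (E := H)).tendsto (T x, y)).comp
      ((hTx x).prodMk_nhds tendsto_const_nhds)
    have h2 := ((CStarModule.continuous_inner (A := A) (E := H)).tendsto (x, S y)).comp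
      (tendsto_const_nhds.prodMk_nhds (hSx y))
    refine tendsto_nhds_unique h1 (h2.congr fun n => ?_)
    exact inner_star_right (u n) x y
  · exact hiso.isEmbedding.tendsto_nhds_iff.mpr hT

noncomputable instance : CStarAlgebra (AdjointableMap A H H) where

instance : StarOrderedRing (AdjointableMap A H H) := by
  refine StarOrderedRing.of_nonneg_iff' (fun {S T} h R x => ?_) fun T => ⟨fun h => ?_, ?_⟩
  · rw [add_sub_add_left_eq_sub]
    exact h x
  · have hT : IsSelfAdjoint T := isSelfAdjoint_of_nonneg h
    set f : ℝ → ℝ := fun t => √(max (-t) 0) with hf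
    set g : ℝ → ℝ := fun t => max (-t) 0 with hg
    have hfc : Continuous f := by fun_prop
    have hgc : Continuous g := by fun_prop
    have hm : cfc (fun t => f t * g t) T = 0 := by
      refine ext fun x => ?_
      have e1 : cfc g T * T * cfc g T
          = -(star (cfc (fun t => f t * g t) T) * cfc (fun t => f t * g t) T) := by
        have hs : star (cfc (fun t => f t * g t) T) = cfc (fun t => f t * g t) T :=
          (cfc_predicate (R := ℝ) _ T).star_eq
        conv_lhs => enter [1, 2]; rw [← cfc_id' ℝ T]
        rw [hs, ← cfc_mul .., ← cfc_mul .., ← cfc_mul .., ← cfc_neg ..]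
        refine cfc_congr fun t _ => ?_
        have hsq : f t * f t = g t := Real.mul_self_sqrt (le_max_right _ _)
        have : g t * t = - (g t * g t) := by
          simp only [hg]
          rcases le_total t 0 with ht | ht
          · rw [max_eq_left (by linarith)]; ring
          · rw [max_eq_right (by linarith)]; ring
        linear_combination g t * this + g t * g t * hsq
      have hn := nonneg_def.mp h (cfc g T x)
      have hgs : star (cfc g T) = cfc g T := (cfc_predicate (R := ℝ) g T).star_eq
      have e2 : inner A ((cfc g T * T * cfc g T) x) x
          = inner A (T (cfc g T x)) (cfc g T x) := by
        have := inner_star_left (A := A) (cfc g T) (T (cfc g T x)) x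
        rw [hgs] at this
        exact this
      set m := cfc (fun t => f t * g t) T
      have e3 : inner A ((-(star m * m)) x) x = -inner A (m x) (m x) := by
        rw [← inner_star_left]
        exact CStarModule.inner_neg_left
      rw [← e2, e1, e3] at hn
      exact (CStarModule.inner_self (A := A)).mp
        (le_antisymm (neg_nonneg.mp hn) CStarModule.inner_self_nonneg)
    have hT0 : Set.EqOn (fun t => f t * g t) 0 (spectrum ℝ T) := by
      rw [← cfc_zero ℝ T] at hm
      exact (cfc_eq_cfc_iff_eqOn ..).mp hm
    refine ⟨cfc Real.sqrt T, ?_⟩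
    have hs : star (cfc Real.sqrt T) = cfc Real.sqrt T := (cfc_predicate (R := ℝ) _ T).star_eq
    rw [hs, ← cfc_mul ..]
    conv_lhs => rw [← cfc_id' ℝ T]
    refine cfc_congr fun t ht => ?_
    have h0 : f t * g t = 0 := hT0 ht
    by_contra hne
    have hneg : t < 0 := by
      by_contra h'
      exact hne (Real.mul_self_sqrt (not_lt.mp h')).symm
    have : 0 < f t * g t := by
      have : 0 < max (-t) 0 := lt_max_of_lt_left (by linarith)
      exact mul_pos (Real.sqrt_pos.mpr this) this
    exact this.ne' h0
  · rintro ⟨S, rfl⟩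
    refine nonneg_def.mpr fun x => ?_
    rw [mul_apply, inner_star_left]
    exact CStarModule.inner_self_nonneg

end Algebra

/-! ### Absolute value -/

section Abs

variable {A H K : Type*} [NonUnitalCStarAlgebra A] [PartialOrder A] [StarOrderedRing A]
  [NormedAddCommGroup H] [NormedSpace ℂ H] [SMul A H] [CStarModule A H] [CompleteSpace H]
  [NormedAddCommGroup K] [NormedSpace ℂ K] [SMul A K] [CStarModule A K]

/-- The absolute value `|T| = (T* T)^{1/2}` of an adjointable operator `T : H → K`, the square
root being taken in the C⋆-algebra of adjointable operators on `H`. Its powers `T.absVal ^ α`,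
`α : ℝ`, are those of the continuous functional calculus (`CFC.rpow`); `T.absVal ^ 0` is the
identity. -/
noncomputable def absVal (T : AdjointableMap A H K) : AdjointableMap A H H :=
  CFC.sqrt (T.adjoint.comp T)

end Abs

end AdjointableMap

/-! Put a = T*T and b = TT*, so that |T|^α = a^(α/2) and |T*|^(2-α) = b^(1-α/2). For a positive
continuous weight w with g = √w, one has ⟨Tx, y⟩ = ⟨g(a)x, g(a)⁻¹T*y⟩, and Cauchy–Schwarz bounds the
norm by ‖g(a)x‖ ‖g(a)⁻¹T*y‖. The first factor squared is ‖⟨w(a)x, x⟩‖. Since T*b = aT*, functional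
calculus gives T* f(b) = f(a) T* (`cfc_intertwine`), so the second factor squared is ‖⟨b w(b)⁻¹y,
y⟩‖. This is `norm_inner_sq_le_weight`.

The natural weight t^(α/2) may vanish at 0, so t^(α/2) + δ is used. On t ≥ 0 it satisfies t /
(t^(α/2) + δ) ≤ t^(1-α/2), and the extra δ‖x‖² in the first factor disappears as δ → 0. No polar
decomposition of T enters; it need not exist in Hilbert modules. -/

/-- A real number that is at most `c + δ * d` for all `δ > 0` is at most `c`. -/
theorem le_of_forall_pos_le_add_mul {b c d : ℝ} (h : ∀ δ > 0, b ≤ c + δ * d) : b ≤ c := by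
  have hlim : Filter.Tendsto (fun δ : ℝ => c + δ * d) (nhdsWithin 0 (Set.Ioi 0)) (nhds c) := by
    have : Filter.Tendsto (fun δ : ℝ => c + δ * d) (nhds 0) (nhds (c + 0 * d)) :=
      (by fun_prop : Continuous fun δ : ℝ => c + δ * d).tendsto 0
    rw [zero_mul, add_zero] at this
    exact this.mono_left nhdsWithin_le_nhds
  exact ge_of_tendsto hlim (by filter_upwards [self_mem_nhdsWithin] with δ hδ using h δ hδ)

namespace AdjointableMap

variable {A H K : Type*} [NonUnitalCStarAlgebra A] [PartialOrder A]
  [NormedAddCommGroup H] [NormedSpace ℂ H] [SMul A H] [CStarModule A H]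
  [NormedAddCommGroup K] [NormedSpace ℂ K] [SMul A K] [CStarModule A K]

/-! ### Positive operators and powers of the absolute value -/

theorem inner_mul_self_apply {S : AdjointableMap A H H} (hS : IsSelfAdjoint S) (x : H) :
    inner A ((S * S) x) x = inner A (S x) (S x) := by
  have := inner_star_left (A := A) S (S x) x
  rwa [hS.star_eq] at this

variable [StarOrderedRing A]

theorem norm_inner_le_of_le {S R : AdjointableMap A H H} (hS : 0 ≤ S) (hSR : S ≤ R) (x : H) :
    ‖inner A (S x) x‖ ≤ ‖inner A (R x) x‖ := by
  refine CStarAlgebra.norm_le_norm_of_nonneg_of_le (nonneg_def.mp hS x) ?_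
  have : 0 ≤ inner A (R x - S x) x := hSR x
  rwa [CStarModule.inner_sub_left, sub_nonneg] at this

theorem adjoint_comp_self_nonneg (T : AdjointableMap A H K) : 0 ≤ T.adjoint.comp T :=
  nonneg_def.mpr fun x => by
    have : inner A (T.adjoint.comp T x) x = inner A (T x) (T x) := T.adjoint.inner_adj (T x) x
    rw [this]
    exact CStarModule.inner_self_nonneg

variable [CompleteSpace H]

/-- Since T*T has nonnegative spectrum, |t| may replace t; this makes the function continuous on all
of ℝ. At α = 0 the convention 0^0 = 1 yields the identity. -/
theorem absVal_rpow (T : AdjointableMap A H K) {α : ℝ} (hα : 0 ≤ α) :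
    T.absVal ^ α = cfc (fun t : ℝ => |t| ^ (α / 2)) (T.adjoint.comp T) := by
  have h0 := T.adjoint_comp_self_nonneg
  rw [absVal, CFC.sqrt_eq_rpow, CFC.rpow_rpow_of_exponent_nonneg _ _ _ (by norm_num) hα h0,
    CFC.rpow_eq_cfc_real h0]
  refine cfc_congr fun t ht => ?_
  simp only [abs_of_nonneg (spectrum_nonneg_of_nonneg h0 ht)]
  congr 1
  ring

/-! ### Intertwining of functional calculi -/

variable [CompleteSpace K]

theorem algebraMap_real_apply (r : ℝ) (x : H) :
    algebraMap ℝ (AdjointableMap A H H) r x = (r : ℂ) • x := by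
  rw [Algebra.algebraMap_eq_smul_one]
  rfl

theorem aeval_intertwine (T : AdjointableMap A H K) {a : AdjointableMap A H H}
    {b : AdjointableMap A K K} (hab : ∀ x, T (a x) = b (T x)) (q : Polynomial ℝ) (x : H) :
    T (Polynomial.aeval a q x) = Polynomial.aeval b q (T x) := by
  induction q using Polynomial.induction_on generalizing x with
  | C r =>
    simp only [Polynomial.aeval_C, algebraMap_real_apply]
    exact T.toLinear.map_smul _ x
  | add p q hp hq =>
    simp only [map_add, add_apply]
    rw [← hp, ← hq]
    exact T.toLinear.map_add _ _
  | monomial n r ih =>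
    rw [pow_succ, ← mul_assoc, map_mul _ _ Polynomial.X, map_mul _ _ Polynomial.X, Polynomial.aeval_X,
      Polynomial.aeval_X, mul_apply, mul_apply, ih, hab]

/-- If `T a = b T` with `a`, `b` self-adjoint, then `T f(a) = f(b) T` for continuous `f`. -/
theorem cfc_intertwine (T : AdjointableMap A H K) {a : AdjointableMap A H H}
    {b : AdjointableMap A K K} (ha : IsSelfAdjoint a) (hb : IsSelfAdjoint b)
    (hab : ∀ x, T (a x) = b (T x)) {f : ℝ → ℝ} (hf : Continuous f) (x : H) :
    T (cfc f a x) = cfc f b (T x) := by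
  rw [← sub_eq_zero, ← norm_le_zero_iff]
  refine le_of_forall_pos_le_add_mul (d := ‖T.toCLM‖ * ‖x‖ + ‖T x‖) fun δ hδ => ?_
  -- [-M, M] contains both spectra, so one polynomial serves a and b. The factors ‖1‖ stay because
  -- the norm of 1 is 0 on a zero module.
  set M : ℝ := max (‖a‖ * ‖(1 : AdjointableMap A H H)‖) (‖b‖ * ‖(1 : AdjointableMap A K K)‖)
  obtain ⟨q, hq⟩ := exists_polynomial_near_of_continuousOn (-M) M f hf.continuousOn δ hδ
  have hna : ‖cfc f a - Polynomial.aeval a q‖ ≤ δ := by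
    rw [← cfc_polynomial q a, ← cfc_sub f (fun t => q.eval t) a hf.continuousOn
      q.continuous.continuousOn]
    refine norm_cfc_le hδ.le fun t ht => ?_
    rw [norm_sub_rev]
    exact (hq t (abs_le.mp ((spectrum.norm_le_norm_mul_of_mem ht).trans (le_max_left _ _)))).le
  have hnb : ‖Polynomial.aeval b q - cfc f b‖ ≤ δ := by
    rw [← cfc_polynomial q b, ← cfc_sub (fun t => q.eval t) f b q.continuous.continuousOn
      hf.continuousOn]
    refine norm_cfc_le hδ.le fun t ht => ?_
    exact (hq t (abs_le.mp ((spectrum.norm_le_norm_mul_of_mem ht).trans (le_max_right _ _)))).le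
  -- T q(a)x and q(b) Tx coincide, so only the two approximation errors remain.
  have hsplit : T (cfc f a x) - cfc f b (T x) =
      T ((cfc f a - Polynomial.aeval a q) x) + (Polynomial.aeval b q - cfc f b) (T x) := by
    have : T ((cfc f a - Polynomial.aeval a q) x) = T (cfc f a x) - T (Polynomial.aeval a q x) :=
      T.toLinear.map_sub _ _
    rw [this, sub_apply, aeval_intertwine T hab]
    abel
  rw [hsplit, zero_add]
  calc ‖T ((cfc f a - Polynomial.aeval a q) x) + (Polynomial.aeval b q - cfc f b) (T x)‖
      ≤ ‖T.toCLM‖ * (δ * ‖x‖) + δ * ‖T x‖ := by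
        refine (norm_add_le _ _).trans (add_le_add ?_ ?_)
        · refine (T.toCLM.le_opNorm _).trans ?_
          gcongr
          exact (norm_apply_le _ _).trans (by gcongr)
        · exact (norm_apply_le _ _).trans (by gcongr)
    _ = δ * (‖T.toCLM‖ * ‖x‖ + ‖T x‖) := by ring

/-! ### The weighted inequality -/

/-- The weighted Cauchy–Schwarz inequality: `‖⟨Tx, y⟩‖² ≤ ‖⟨w(T*T) x, x⟩‖ ‖⟨(t / w)(TT*) y, y⟩‖`
for a positive continuous weight `w`. -/
theorem norm_inner_sq_le_weight (T : AdjointableMap A H K) {w : ℝ → ℝ} (hw : Continuous w)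
    (hpos : ∀ t, 0 < w t) (x : H) (y : K) :
    ‖inner A (T x) y‖ ^ 2 ≤ ‖inner A (cfc w (T.adjoint.comp T) x) x‖ *
      ‖inner A (cfc (fun t => t * (w t)⁻¹) (T.comp T.adjoint) y) y‖ := by
  set a := T.adjoint.comp T
  set b := T.comp T.adjoint
  have ha : IsSelfAdjoint a := rfl
  have hb : IsSelfAdjoint b := rfl
  set g : ℝ → ℝ := fun t => √(w t) with hg
  have hg0 (t : ℝ) : g t ≠ 0 := (Real.sqrt_pos.mpr (hpos t)).ne'
  have hgc : Continuous g := by fun_prop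
  have hhc : Continuous fun t => (g t)⁻¹ := hgc.inv₀ hg0
  have hwc : Continuous fun t => (w t)⁻¹ := hw.inv₀ fun t => (hpos t).ne'
  have hgg : cfc g a * cfc g a = cfc w a := by
    rw [← cfc_mul ..]
    exact cfc_congr fun t _ => Real.mul_self_sqrt (hpos t).le
  have hhh : cfc (fun t => (g t)⁻¹) a * cfc (fun t => (g t)⁻¹) a = cfc (fun t => (w t)⁻¹) a := by
    rw [← cfc_mul _ _ a hhc.continuousOn hhc.continuousOn]
    refine cfc_congr fun t _ => ?_
    simp only [hg]
    rw [← mul_inv, Real.mul_self_sqrt (hpos t).le]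
  have hhg : cfc (fun t => (g t)⁻¹) a * cfc g a = 1 := by
    rw [← cfc_mul _ _ a hhc.continuousOn hgc.continuousOn, ← cfc_one ℝ a]
    exact cfc_congr fun t _ => inv_mul_cancel₀ (hg0 t)
  have hbw : b * cfc (fun t => (w t)⁻¹) b = cfc (fun t => t * (w t)⁻¹) b := by
    rw [cfc_mul (fun t => t) _ b continuousOn_id hwc.continuousOn, cfc_id' ℝ b]
  have hgs : star (cfc g a) = cfc g a := (cfc_predicate (R := ℝ) g a).star_eq
  have hhs : star (cfc (fun t => (g t)⁻¹) a) = cfc (fun t => (g t)⁻¹) a :=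
    (cfc_predicate (R := ℝ) _ a).star_eq
  set u := cfc g a x with hu
  set v := cfc (fun t => (g t)⁻¹) a (T.adjoint y) with hv
  -- Insert g(a)⁻¹g(a) = 1 before x and move the self-adjoint g(a)⁻¹ to the other side.
  have huv : inner A (T x) y = inner A u v := by
    have hx : cfc (fun t => (g t)⁻¹) a (cfc g a x) = x := by
      rw [← mul_apply, hhg, one_apply]
    rw [hv, ← inner_star_left, hhs, hx]
    exact T.inner_adj x y
  have huu : ‖u‖ ^ 2 = ‖inner A (cfc w a x) x‖ := by
    rw [CStarModule.norm_sq_eq A, ← hgg, inner_mul_self_apply hgs]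
  have hvv : ‖v‖ ^ 2 = ‖inner A (cfc (fun t => t * (w t)⁻¹) b y) y‖ := by
    -- T* intertwines b with a by associativity: T*(TT*) = (T*T)T*.
    have hT : cfc (fun t => (w t)⁻¹) a (T.adjoint y)
        = T.adjoint (cfc (fun t => (w t)⁻¹) b y) :=
      (cfc_intertwine T.adjoint hb ha (fun _ => rfl) hwc y).symm
    rw [CStarModule.norm_sq_eq A, ← hbw]
    have h1 : inner A v v = inner A (cfc (fun t => (w t)⁻¹) a (T.adjoint y)) (T.adjoint y) := by
      rw [← hhh, inner_mul_self_apply hhs]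
    rw [h1, hT]
    exact congrArg _ (T.inner_adj (T.adjoint (cfc (fun t => (w t)⁻¹) b y)) y).symm
  rw [huv, ← huu, ← hvv, ← mul_pow]
  gcongr
  exact CStarModule.norm_inner_le H

end AdjointableMap

/-! ### The mixed Schwarz inequality -/

theorem theorem3p2 {A H K : Type*}
    [NonUnitalCStarAlgebra A] [PartialOrder A] [StarOrderedRing A]
    [NormedAddCommGroup H] [NormedSpace ℂ H] [SMul A H] [CStarModule A H] [CompleteSpace H]
    [NormedAddCommGroup K] [NormedSpace ℂ K] [SMul A K] [CStarModule A K] [CompleteSpace K]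
    (T : AdjointableMap A H K) (α : ℝ) (hα : α ∈ Set.Icc (0 : ℝ) 2) (x : H) (y : K) :
    ‖inner A (T x) y‖ ^ 2 ≤
      ‖inner A ((T.absVal ^ α) x) x‖ * ‖inner A ((T.adjoint.absVal ^ (2 - α)) y) y‖ := by
  obtain ⟨h0, h2⟩ := hα
  set Q := ‖inner A ((T.adjoint.absVal ^ (2 - α)) y) y‖ with hQ
  -- The error δ‖x‖²Q comes from adding δ to the weight, which makes it strictly positive.
  refine le_of_forall_pos_le_add_mul (d := ‖x‖ ^ 2 * Q) fun δ hδ => ?_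
  have hpc : Continuous fun t : ℝ => |t| ^ (α / 2) :=
    continuous_abs.rpow_const fun _ => Or.inr (by linarith)
  have hp0 (t : ℝ) : 0 ≤ |t| ^ (α / 2) := Real.rpow_nonneg (abs_nonneg t) _
  have hwpos (t : ℝ) : 0 < |t| ^ (α / 2) + δ := by linarith [hp0 t]
  have hwc : Continuous fun t : ℝ => |t| ^ (α / 2) + δ := hpc.add continuous_const
  have hb0 : 0 ≤ T.comp T.adjoint := T.adjoint.adjoint_comp_self_nonneg
  have hx : ‖inner A (cfc (fun t : ℝ => |t| ^ (α / 2) + δ) (T.adjoint.comp T) x) x‖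
      ≤ ‖inner A ((T.absVal ^ α) x) x‖ + δ * ‖x‖ ^ 2 := by
    have ha : IsSelfAdjoint (T.adjoint.comp T) := rfl
    rw [cfc_add_const δ _ _ hpc.continuousOn ha, ← AdjointableMap.absVal_rpow T h0, AdjointableMap.add_apply,
      AdjointableMap.algebraMap_real_apply, CStarModule.inner_add_left, CStarModule.inner_smul_left_complex]
    refine (norm_add_le _ _).trans (add_le_add le_rfl ?_)
    rw [norm_smul, CStarModule.norm_sq_eq A]
    simp [abs_of_pos hδ]
  have hy : ‖inner A (cfc (fun t : ℝ => t * (|t| ^ (α / 2) + δ)⁻¹) (T.comp T.adjoint) y) y‖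
      ≤ Q := by
    have hrpow : T.adjoint.absVal ^ (2 - α)
        = cfc (fun t : ℝ => |t| ^ ((2 - α) / 2)) (T.comp T.adjoint) :=
      AdjointableMap.absVal_rpow T.adjoint (sub_nonneg.mpr h2)
    rw [hQ, hrpow]
    have hbsa : IsSelfAdjoint (T.comp T.adjoint) := rfl
    refine AdjointableMap.norm_inner_le_of_le (cfc_nonneg fun t ht => ?_) (cfc_mono (fun t ht => ?_) ?_ ?_) y
    · exact mul_nonneg (spectrum_nonneg_of_nonneg hb0 ht) (inv_nonneg.mpr (hwpos t).le)
    · have ht0 : 0 ≤ t := spectrum_nonneg_of_nonneg hb0 ht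
      -- Both exponents are nonnegative because 0 ≤ α ≤ 2, so they add even at t = 0.
      have hpow : |t| ^ ((2 - α) / 2) * |t| ^ (α / 2) = t := by
        rw [← Real.rpow_add_of_nonneg (abs_nonneg t) (by linarith) (by linarith),
          abs_of_nonneg ht0, show (2 - α) / 2 + α / 2 = 1 by ring, Real.rpow_one]
      -- After clearing the denominator, the claim is t ≤ t + t^(1-α/2) δ.
      rw [← div_eq_mul_inv, div_le_iff₀ (hwpos t), mul_add, hpow]
      exact le_add_of_nonneg_right (by positivity)
    · exact (continuous_id.mul (hwc.inv₀ fun t => (hwpos t).ne')).continuousOn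
    · exact (continuous_abs.rpow_const fun _ => Or.inr (by linarith)).continuousOn
  calc ‖inner A (T x) y‖ ^ 2 ≤ _ := AdjointableMap.norm_inner_sq_le_weight T hwc hwpos x y
    _ ≤ (‖inner A ((T.absVal ^ α) x) x‖ + δ * ‖x‖ ^ 2) * Q := by gcongr
    _ = _ := by ring
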